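/- Let $k\ge 2$ be an integer. A $k$-graph is a finite vertex set together with a set of $k$-element subsets of it (edges); for a family $\mathcal F$ of $k$-graphs, a $k$-graph is $\mathcal F$-free if it contains no member of $\mathcal F$ as a (not necessarily induced) sub-hypergraph. Let $\mathrm{ex}(n,\mathcal F)$ be the maximum number of edges of an $n$-vertex $\mathcal F$-free $k$-graph ($0$ if there is none), and let $\pi(\mathcal F)=\lim_{n\to\infty}\mathrm{ex}(n,\mathcal F)/\binom nk$. For $\alpha>1$ and a $k$-graph $G$ with vertex set $\{1,\dots,n\}$ and edge set $E(G)$, its $\alpha$-spectral radius is $$\lambda_\alpha(G)=\max_{|x_1|^\alpha+\cdots+|x_n|^\alpha=1}\; k!\sum_{\{i_1,\dots,i_k\}\in E(G)}x_{i_1}\cdots x_{i_k}.$$ Let $k\ge2$, $\alpha>1$, $0<\varepsilon<1$, and let $\mathcal F$ be a family of $k$-graphs with $\pi(\mathcal F)>0$. Let $\mathcal G_n$ be the collection of all $n$-vertex $\mathcal F$-free $k$-graphs with minimum degree at least $(1-\varepsilon)\pi(\mathcal F)\binom{n}{k-1}$, where the degree of a vertex is the number of edges containing it, and let $\lambda_\alpha(\mathcal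 G_n)=\max\{\lambda_\alpha(G):G\in\mathcal G_n\}$ (read as $0$ if $\mathcal G_n=\emptyset$). Put $\varepsilon'=\varepsilon\,\pi(\mathcal F)(\alpha-1)/(2k\alpha)$, and suppose that there is $N$ such that for all $n\ge N$ $$\lambda_\alpha(\mathcal G_n)\ \ge\ \lambda_\alpha(\mathcal G_{n-1})+(k-k/\alpha)(1-\varepsilon')\,\pi(\mathcal F)\,n^{k-k/\alpha-1}.$$ Then there exists $n_0$ such that every $\mathcal F$-free $k$-graph $H$ on $n\ge n_0$ vertices satisfies $\lambda_\alpha(H)\le\lambda_\alpha(\mathcal G_n)$; moreover, if equality holds, then $H\in\mathcal G_n$. -/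

import Mathlib

/-- A `k`-uniform hypergraph (`k`-graph) with vertex set `V`: a finite set of `k`-element
subsets of `V`. -/
@[ext]
structure KGraph (V : Type*) (k : ℕ) where
  edges : Finset (Finset V)
  uniform : ∀ e ∈ edges, e.card = k

/-- A family of finite `k`-graphs; every finite `k`-graph is taken, up to isomorphism, on a
vertex set `Fin m`. -/
abbrev KFamily (k : ℕ) := Set (Σ m : ℕ, KGraph (Fin m) k)

namespace KGraph

/-- `H` contains a copy of `F` as a (not necessarily induced) sub-hypergraph. -/
def Contains {V W : Type*} {k : ℕ} (H : KGraph V k) (F : KGraph W k) : Prop :=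
  ∃ φ : W ↪ V, ∀ e ∈ F.edges, e.map φ ∈ H.edges

/-- `H` contains no member of the family `𝓕` as a sub-hypergraph. -/
def IsFree {V : Type*} {k : ℕ} (𝓕 : KFamily k) (H : KGraph V k) : Prop :=
  ∀ F ∈ 𝓕, ¬ H.Contains F.2

/-- The number of edges containing the vertex `v`. -/
def degree {V : Type*} [DecidableEq V] {k : ℕ} (H : KGraph V k) (v : V) : ℕ :=
  (H.edges.filter (fun e => v ∈ e)).card

/-- The minimum degree (it is `0` if there are no vertices). -/
noncomputable def minDegree {V : Type*} [DecidableEq V] {k : ℕ} (H : KGraph V k) : ℕ :=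
  ⨅ v : V, H.degree v

/-- The Lagrangian polynomial `k! * ∑_{e ∈ E(H)} ∏_{v ∈ e} x_v`. -/
noncomputable def lagrangian {V : Type*} {k : ℕ} (H : KGraph V k) (x : V → ℝ) : ℝ :=
  (k.factorial : ℝ) * ∑ e ∈ H.edges, ∏ v ∈ e, x v

/-- The `α`-spectral radius: the maximum of the Lagrangian polynomial over the real vectors `x`
with `‖x‖_α = 1` (a compact nonempty set if there is at least one vertex; for no vertices the
value is `0`). -/
noncomputable def spectralRadius {V : Type*} [Fintype V] {k : ℕ} (α : ℝ) (H : KGraph V k) : ℝ :=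
  sSup {y : ℝ | ∃ x : V → ℝ, (∑ v, |x v| ^ α) ^ (1 / α) = 1 ∧ H.lagrangian x = y}

end KGraph

namespace KFamily

/-- The Turán number `ex(n, 𝓕)`: the maximum number of edges of an `𝓕`-free `k`-graph on `n`
vertices. -/
noncomputable def ex {k : ℕ} (𝓕 : KFamily k) (n : ℕ) : ℕ :=
  sSup {m : ℕ | ∃ G : KGraph (Fin n) k, G.IsFree 𝓕 ∧ G.edges.card = m}

/-- The Turán density `π(𝓕) = lim ex(n, 𝓕) / (n choose k)`. -/
noncomputable def density {k : ℕ} (𝓕 : KFamily k) : ℝ :=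
  Filter.limUnder Filter.atTop (fun n : ℕ => (𝓕.ex n : ℝ) / (n.choose k : ℝ))

/-- The `𝓕`-free `k`-graphs on `n` vertices with minimum degree at least
`(1 - ε) * π(𝓕) * (n choose (k - 1))`. -/
def largeMinDegree {k : ℕ} (𝓕 : KFamily k) (ε : ℝ) (n : ℕ) : Set (KGraph (Fin n) k) :=
  {G | G.IsFree 𝓕 ∧ (1 - ε) * 𝓕.density * (n.choose (k - 1) : ℝ) ≤ (G.minDegree : ℝ)}

end KFamily

/-- The maximum `α`-spectral radius over a set of `k`-graphs on `n` vertices. Such a set is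
finite, so this is a maximum if the set is nonempty; for the empty set the value is `0`. -/
noncomputable def maxSpectralRadius {k n : ℕ} (α : ℝ) (𝓖 : Set (KGraph (Fin n) k)) : ℝ :=
  sSup (KGraph.spectralRadius α '' 𝓖)

/-!
Write `L n` for the largest `α`-spectral radius of an `𝓕`-free `k`-graph on `n` vertices and
`p = k - k / α`. Weighting every `m`-set of vertices by the product of its coordinates, an average
over all `m`-sets bounds the Lagrangian polynomial of an `𝓕`-free `k`-graph by
`(ex(m, 𝓕) / (m choose k) + o(1)) * (∑ v, x v) ^ k`; together with Hölder's inequality this gives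
`L n ∼ π(𝓕) * n ^ p`.

Let `H` be extremal with a vertex `u` of degree below `(1 - ε) * π(𝓕) * (n choose (k - 1))`. If all
`x v ^ α` of a principal vector `x` were at least `b / n`, the eigenvalue equation at `u` would make
`L n` too small when `b` is close to `1`; so some `x w ^ α` is less than `b / n`, and deleting `w`
costs at most `(1 - ε' - δ) * p * π(𝓕) * n ^ (p - 1)` for a fixed `δ > 0`. The largest spectral
radius with large minimum degree grows faster, so while no extremal `H` has large minimum degree,
the gap between the two maxima decreases by at least a constant times `1 / n` at each step. The
harmonic series diverges, hence the gap closes, and it never reopens.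
-/

open Finset Filter Topology

section ElementarySymmetric

variable {ι R : Type*}

lemma sum_powersetCard_filter_superset [DecidableEq ι] [CommSemiring R] {e s : Finset ι}
    (h : e ⊆ s) {m : ℕ} (hm : #e ≤ m) (x : ι → R) :
    ∑ t ∈ s.powersetCard m with e ⊆ t, ∏ i ∈ t, x i =
      (∏ i ∈ e, x i) * ∑ t ∈ (s \ e).powersetCard (m - #e), ∏ i ∈ t, x i := by
  rw [mul_sum]
  refine sum_bij' (fun t _ => t \ e) (fun t _ => t ∪ e) ?_ ?_ ?_ ?_ ?_ <;>
    simp only [mem_filter, mem_powersetCard, subset_sdiff]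
  · rintro t ⟨⟨hts, rfl⟩, het⟩
    exact ⟨⟨sdiff_subset.trans hts, sdiff_disjoint⟩, card_sdiff_of_subset het⟩
  · rintro t ⟨⟨hts, hdisj⟩, hcard⟩
    refine ⟨⟨union_subset hts h, ?_⟩, subset_union_right⟩
    rw [card_union_of_disjoint hdisj, hcard, Nat.sub_add_cancel hm]
  · exact fun t ht => sdiff_union_of_subset ht.2
  · exact fun t ht => union_sdiff_cancel_right ht.1.2
  · exact fun t ht => by rw [mul_comm, prod_sdiff ht.2]

lemma factorial_succ_mul_sum_powersetCard [DecidableEq ι] [CommSemiring R] (s : Finset ι) (j : ℕ)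
    (x : ι → R) :
    ((j + 1).factorial : R) * ∑ t ∈ s.powersetCard (j + 1), ∏ i ∈ t, x i =
      ∑ i ∈ s, x i * (j.factorial * ∑ t ∈ (s.erase i).powersetCard j, ∏ l ∈ t, x l) := by
  have hcontain : ∀ i ∈ s, x i * ∑ t ∈ (s.erase i).powersetCard j, ∏ l ∈ t, x l =
      ∑ t ∈ s.powersetCard (j + 1), if i ∈ t then ∏ l ∈ t, x l else 0 := by
    intro i hi
    have h := sum_powersetCard_filter_superset (singleton_subset_iff.2 hi) (m := j + 1)
      (Nat.le_add_left 1 j) x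
    simpa [sdiff_singleton_eq_erase, sum_filter] using h.symm
  have hcount : ∀ t ∈ s.powersetCard (j + 1), (∑ i ∈ s, if i ∈ t then ∏ l ∈ t, x l else 0) =
      ((j + 1 : ℕ) : R) * ∏ l ∈ t, x l := by
    intro t ht
    obtain ⟨hts, hcard⟩ := mem_powersetCard.1 ht
    rw [← sum_filter, filter_mem_eq_inter, inter_eq_right.2 hts, sum_const, hcard, nsmul_eq_mul]
  simp_rw [mul_left_comm (x _)]
  rw [← mul_sum, sum_congr rfl hcontain, sum_comm, sum_congr rfl hcount, ← mul_sum,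
    Nat.factorial_succ, Nat.cast_mul]
  ring

variable [CommRing R] [LinearOrder R] [IsStrictOrderedRing R]

lemma factorial_mul_sum_powersetCard_le (j : ℕ) {s : Finset ι} {x : ι → R}
    (hx : ∀ i ∈ s, 0 ≤ x i) :
    (j.factorial : R) * ∑ t ∈ s.powersetCard j, ∏ i ∈ t, x i ≤ (∑ i ∈ s, x i) ^ j := by
  classical
  induction j generalizing s with
  | zero => simp
  | succ j ih =>
    rw [factorial_succ_mul_sum_powersetCard, pow_succ', sum_mul]
    refine sum_le_sum fun i hi => mul_le_mul_of_nonneg_left ?_ (hx i hi)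
    have hx' : ∀ l ∈ s.erase i, 0 ≤ x l := fun l hl => hx l (mem_of_mem_erase hl)
    exact (ih hx').trans <| pow_le_pow_left₀ (sum_nonneg hx')
      (sum_le_sum_of_subset_of_nonneg (erase_subset i s) fun l hl _ => hx l hl) j

lemma sub_pow_le_factorial_mul_sum_powersetCard (j : ℕ) {s : Finset ι} {x : ι → R}
    (hx : ∀ i ∈ s, 0 ≤ x i) (hx1 : ∀ i ∈ s, x i ≤ 1) (hs : (j : R) ≤ ∑ i ∈ s, x i) :
    (∑ i ∈ s, x i - j) ^ j ≤ (j.factorial : R) * ∑ t ∈ s.powersetCard j, ∏ i ∈ t, x i := by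
  classical
  induction j generalizing s with
  | zero => simp
  | succ j ih =>
    have hj : (0 : R) ≤ j := j.cast_nonneg
    rw [Nat.cast_succ] at hs
    rw [factorial_succ_mul_sum_powersetCard, Nat.cast_succ]
    calc (∑ i ∈ s, x i - (j + 1)) ^ (j + 1)
        ≤ (∑ i ∈ s, x i) * (∑ i ∈ s, x i - (j + 1)) ^ j := by
          rw [pow_succ']
          exact mul_le_mul_of_nonneg_right (by linarith) (pow_nonneg (by linarith) j)
      _ ≤ _ := by
          rw [sum_mul]
          refine sum_le_sum fun i hi => mul_le_mul_of_nonneg_left ?_ (hx i hi)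
          have hsum := add_sum_erase s x hi
          have hxi := hx1 i hi
          refine le_trans (pow_le_pow_left₀ (by linarith) (by linarith) j)
            (ih (fun l hl => hx l (mem_of_mem_erase hl))
              (fun l hl => hx1 l (mem_of_mem_erase hl)) (by linarith))

end ElementarySymmetric

lemma tendsto_factorial_mul_choose_div_pow (k : ℕ) :
    Tendsto (fun n : ℕ => (k.factorial : ℝ) * n.choose k / (n : ℝ) ^ k) atTop (𝓝 1) := by
  have hne : ∀ᶠ n : ℕ in atTop, ((n : ℝ) ^ k / k.factorial : ℝ) ≠ 0 := by
    filter_upwards [eventually_gt_atTop 0] with n hn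
    positivity
  refine ((Asymptotics.isEquivalent_iff_tendsto_one hne).1 (isEquivalent_choose k)).congr
    fun n => ?_
  rw [Pi.div_apply, div_div_eq_mul_div, mul_comm]

lemma one_sub_rpow_mul_one_add_le_one {z r : ℝ} (hz : z ≤ 1) (hr : 0 ≤ r) :
    (1 - z) ^ r * (1 + r * z) ≤ 1 := by
  have := sub_nonneg.2 hz
  calc (1 - z) ^ r * (1 + r * z) ≤ (1 - z) ^ r * Real.exp (r * z) := by
        gcongr
        linarith [Real.add_one_le_exp (r * z)]
    _ ≤ Real.exp (-z) ^ r * Real.exp (r * z) := by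
        gcongr
        exact Real.one_sub_le_exp_neg z
    _ = 1 := by rw [← Real.exp_mul, ← Real.exp_add]; simp [mul_comm]

lemma eventually_nonpos_of_decreasing_while_pos {d f : ℕ → ℝ} (hf : ∀ n, 0 ≤ f n)
    (hsum : ¬ Summable f) (h : ∀ᶠ n in atTop, 0 < d (n + 1) → d (n + 1) + f n ≤ d n) :
    ∀ᶠ n in atTop, d n ≤ 0 := by
  obtain ⟨N, hN⟩ := eventually_atTop.1 h
  obtain ⟨n₁, hn₁, hd⟩ : ∃ n ≥ N, d n ≤ 0 := by
    by_contra! hpos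
    have hpartial : ∀ n, ∑ i ∈ range n, f (i + N) ≤ d N - d (n + N) := by
      intro n
      induction n with
      | zero => simp
      | succ n ih =>
        have hstep := hN (n + N) (by lia) (hpos _ (by lia))
        rw [sum_range_succ, Nat.succ_add]
        linarith
    refine hsum ((summable_nat_add_iff N).1 (summable_of_sum_range_le (c := d N)
      (fun i => hf _) fun n => (hpartial n).trans ?_))
    exact sub_le_self _ (hpos _ (by lia)).le
  refine eventually_atTop.2 ⟨n₁, fun n hn => ?_⟩
  induction n, hn using Nat.le_induction with
  | base => exact hd
  | succ n hn ih =>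
    by_contra! hpos
    linarith [hN n (hn₁.trans hn) hpos, hf n]

namespace KGraph

variable {V W : Type*} {k : ℕ}

/-- The `k`-graph on `W` induced by `H` along an embedding of `W` into its vertex set. -/
noncomputable def comap (H : KGraph V k) (φ : W ↪ V) : KGraph W k where
  edges := H.edges.preimage (Finset.map φ) (map_injective φ).injOn
  uniform e he := by rw [← card_map φ, H.uniform _ (mem_preimage.1 he)]

lemma mem_edges_comap {H : KGraph V k} {φ : W ↪ V} {e : Finset W} :
    e ∈ (H.comap φ).edges ↔ e.map φ ∈ H.edges := by
  rw [comap, mem_preimage]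

lemma IsFree.comap {𝓕 : KFamily k} {H : KGraph V k} (h : H.IsFree 𝓕) (φ : W ↪ V) :
    (H.comap φ).IsFree 𝓕 := by
  rintro F hF ⟨ψ, hψ⟩
  refine h F hF ⟨ψ.trans φ, fun e he => ?_⟩
  rw [← Finset.map_map]
  exact mem_edges_comap.1 (hψ e he)

lemma sum_edges_comap {M : Type*} [AddCommMonoid M] [DecidableEq V] [Fintype W] (H : KGraph V k)
    (φ : W ↪ V) (f : Finset V → M) :
    ∑ e ∈ (H.comap φ).edges, f (e.map φ) = ∑ e ∈ H.edges with e ⊆ univ.map φ, f e := by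
  classical
  have hrange : ∀ e : Finset V, e ∈ Set.range (Finset.map φ) ↔ e ⊆ univ.map φ := fun e => by
    simp [subset_map_iff, eq_comm]
  simp only [comap, sum_preimage', hrange]

lemma card_edges_comap [DecidableEq V] [Fintype W] (H : KGraph V k) (φ : W ↪ V) :
    #(H.comap φ).edges = #{e ∈ H.edges | e ⊆ univ.map φ} := by
  simpa only [card_eq_sum_ones] using H.sum_edges_comap φ fun _ => 1

instance [Finite V] : Finite (KGraph V k) :=
  Finite.of_injective KGraph.edges fun _ _ => KGraph.ext

end KGraph

namespace KFamily

variable {k : ℕ} {V : Type*} [DecidableEq V] {𝓕 : KFamily k} {H : KGraph V k}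

lemma bddAbove_card_edges (𝓕 : KFamily k) (n : ℕ) :
    BddAbove {m : ℕ | ∃ G : KGraph (Fin n) k, G.IsFree 𝓕 ∧ #G.edges = m} := by
  refine ((Set.finite_range fun G : KGraph (Fin n) k => #G.edges).subset ?_).bddAbove
  rintro _ ⟨G, -, rfl⟩
  exact ⟨G, rfl⟩

lemma ex_eq_zero_or_exists_card_edges_eq (𝓕 : KFamily k) (n : ℕ) :
    𝓕.ex n = 0 ∨ ∃ G : KGraph (Fin n) k, G.IsFree 𝓕 ∧ #G.edges = 𝓕.ex n := by
  rcases Set.eq_empty_or_nonempty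
    {m : ℕ | ∃ G : KGraph (Fin n) k, G.IsFree 𝓕 ∧ #G.edges = m} with h | h
  · exact .inl (by rw [ex, h, csSup_empty, bot_eq_zero])
  · exact .inr (Nat.sSup_mem h (𝓕.bddAbove_card_edges n))

lemma card_edges_filter_subset_le_ex (hH : H.IsFree 𝓕) {m : ℕ} {M : Finset V} (hM : #M = m) :
    #{e ∈ H.edges | e ⊆ M} ≤ 𝓕.ex m := by
  let φ : Fin m ↪ V := (M.equivFinOfCardEq hM).symm.toEmbedding.trans (.subtype _)
  have hφ : univ.map φ = M := by
    rw [← Finset.map_map, map_univ_equiv, univ_eq_attach, attach_map_val]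
  rw [← hφ, ← H.card_edges_comap φ]
  exact le_csSup (𝓕.bddAbove_card_edges m) ⟨_, hH.comap φ, rfl⟩

-- Both sides count the pairs of an edge and an `m`-set containing it, weighted by the `m`-set.
lemma sum_edges_mul_sum_powersetCard_le [Fintype V] (hH : H.IsFree 𝓕) {m : ℕ} (hm : k ≤ m)
    {x : V → ℝ} (hx : ∀ v, 0 ≤ x v) :
    ∑ e ∈ H.edges, (∏ v ∈ e, x v) * ∑ t ∈ (univ \ e).powersetCard (m - k), ∏ v ∈ t, x v ≤
      𝓕.ex m * ∑ M ∈ univ.powersetCard m, ∏ v ∈ M, x v := by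
  calc _ = ∑ e ∈ H.edges, ∑ M ∈ univ.powersetCard m, if e ⊆ M then ∏ v ∈ M, x v else 0 := by
        refine sum_congr rfl fun e he => ?_
        have hcard := H.uniform e he
        rw [← sum_filter, sum_powersetCard_filter_superset (subset_univ e) (hcard.trans_le hm),
          hcard]
    _ = ∑ M ∈ univ.powersetCard m, (#{e ∈ H.edges | e ⊆ M} : ℝ) * ∏ v ∈ M, x v := by
        rw [sum_comm]
        simp_rw [← sum_filter, sum_const, nsmul_eq_mul]
    _ ≤ _ := by
        rw [mul_sum]
        refine sum_le_sum fun M hM => mul_le_mul_of_nonneg_right ?_ (prod_nonneg fun v _ => hx v)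
        exact_mod_cast card_edges_filter_subset_le_ex hH (mem_powersetCard.1 hM).2

lemma antitoneOn_ex_div_choose (𝓕 : KFamily k) :
    AntitoneOn (fun n : ℕ => (𝓕.ex n : ℝ) / n.choose k) (Set.Ici k) := by
  intro m (hm : k ≤ m) n (hn : k ≤ n) hmn
  have hdouble : 𝓕.ex n * (n - k).choose (m - k) ≤ 𝓕.ex m * n.choose m := by
    rcases 𝓕.ex_eq_zero_or_exists_card_edges_eq n with h | ⟨G, hG, hGn⟩
    · simp [h]
    · have hext : ∀ e ∈ G.edges, #(univ \ e) = n - k := fun e he => by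
        rw [card_univ_sdiff, Fintype.card_fin, G.uniform e he]
      have h := sum_edges_mul_sum_powersetCard_le hG hm fun _ => zero_le_one
      simp only [prod_const_one, sum_const, card_powersetCard, nsmul_eq_mul, mul_one, one_mul,
        card_univ, Fintype.card_fin] at h
      rw [sum_congr rfl fun e he => by rw [hext e he], sum_const, nsmul_eq_mul, hGn] at h
      exact_mod_cast h
  rw [div_le_div_iff₀ (mod_cast Nat.choose_pos hn) (mod_cast Nat.choose_pos hm)]
  norm_cast
  refine le_of_mul_le_mul_right ?_ (Nat.choose_pos (Nat.sub_le_sub_right hmn k))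
  calc 𝓕.ex n * m.choose k * (n - k).choose (m - k)
      = 𝓕.ex n * (n - k).choose (m - k) * m.choose k := mul_right_comm _ _ _
    _ ≤ 𝓕.ex m * n.choose m * m.choose k := Nat.mul_le_mul_right _ hdouble
    _ = 𝓕.ex m * n.choose k * (n - k).choose (m - k) := by
        rw [mul_assoc, Nat.choose_mul hm, mul_assoc]

lemma tendsto_ex_div_choose (𝓕 : KFamily k) :
    Tendsto (fun n : ℕ => (𝓕.ex n : ℝ) / n.choose k) atTop (𝓝 𝓕.density) := by
  refine tendsto_nhds_limUnder ⟨_, (tendsto_add_atTop_iff_nat k).1 (tendsto_atTop_ciInf ?_ ?_)⟩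
  · exact fun m n hmn => 𝓕.antitoneOn_ex_div_choose (Nat.le_add_left k m) (Nat.le_add_left k n)
      (Nat.add_le_add_right hmn k)
  · refine ⟨0, ?_⟩
    rintro _ ⟨n, rfl⟩
    positivity

lemma density_nonneg (𝓕 : KFamily k) : 0 ≤ 𝓕.density :=
  ge_of_tendsto' 𝓕.tendsto_ex_div_choose fun _ => by positivity

lemma tendsto_factorial_mul_ex_div_pow (𝓕 : KFamily k) :
    Tendsto (fun n : ℕ => k.factorial * (𝓕.ex n : ℝ) / (n : ℝ) ^ k) atTop (𝓝 𝓕.density) := by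
  have h := 𝓕.tendsto_ex_div_choose.mul (tendsto_factorial_mul_choose_div_pow k)
  rw [mul_one] at h
  refine h.congr' ?_
  filter_upwards [eventually_ge_atTop k] with n hn
  have hchoose : (n.choose k : ℝ) ≠ 0 := mod_cast (Nat.choose_pos hn).ne'
  field_simp

end KFamily

lemma le_one_of_sum_rpow_eq_one {ι : Type*} [Fintype ι] {α : ℝ} (hα : 0 < α) {x : ι → ℝ}
    (hx : ∀ i, 0 ≤ x i) (hsum : ∑ i, x i ^ α = 1) (i : ι) : x i ≤ 1 := by
  by_contra! h
  exact (Real.one_lt_rpow h hα).not_ge <| hsum ▸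
    single_le_sum (f := fun i => x i ^ α) (fun i _ => Real.rpow_nonneg (hx i) α) (mem_univ i)

lemma isCompact_setOf_sum_abs_rpow_eq_one {ι : Type*} [Fintype ι] {α : ℝ} (hα : 0 < α) :
    IsCompact {x : ι → ℝ | ∑ i, |x i| ^ α = 1} := by
  have hcont : Continuous fun x : ι → ℝ => ∑ i, |x i| ^ α :=
    continuous_finsetSum _ fun i _ => (continuous_apply i).abs.rpow_const fun _ => .inr hα.le
  refine (isCompact_univ_pi fun _ => isCompact_Icc (a := (-1 : ℝ)) (b := 1)).of_isClosed_subset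
    (isClosed_eq hcont continuous_const) fun x hx i _ => abs_le.1 ?_
  exact le_one_of_sum_rpow_eq_one hα (fun i => abs_nonneg (x i)) hx i

lemma nonempty_setOf_sum_abs_rpow_eq_one {ι : Type*} [Fintype ι] [Nonempty ι] {α : ℝ}
    (hα : α ≠ 0) : {x : ι → ℝ | ∑ i, |x i| ^ α = 1}.Nonempty := by
  classical
  obtain ⟨i⟩ := ‹Nonempty ι›
  refine ⟨Pi.single i 1, ?_⟩
  rw [Set.mem_ofPred_eq, sum_eq_single i (fun j _ hj => by simp [hj, hα]) (by simp)]
  simp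

namespace KGraph

variable {V : Type*} {k : ℕ}

section Lagrangian

lemma lagrangian_nonneg (H : KGraph V k) {x : V → ℝ} (hx : ∀ v, 0 ≤ x v) :
    0 ≤ H.lagrangian x :=
  mul_nonneg (Nat.cast_nonneg _) (sum_nonneg fun _ _ => prod_nonneg fun v _ => hx v)

lemma lagrangian_le_lagrangian_abs (H : KGraph V k) (x : V → ℝ) :
    H.lagrangian x ≤ H.lagrangian fun v => |x v| := by
  refine mul_le_mul_of_nonneg_left (sum_le_sum fun e _ => ?_) (Nat.cast_nonneg _)
  rw [← abs_prod]
  exact le_abs_self _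

lemma lagrangian_const_mul (H : KGraph V k) (c : ℝ) (x : V → ℝ) :
    H.lagrangian (fun v => c * x v) = c ^ k * H.lagrangian x := by
  have hprod : ∀ e ∈ H.edges, ∏ v ∈ e, c * x v = c ^ k * ∏ v ∈ e, x v := fun e he => by
    rw [prod_mul_distrib, prod_const, H.uniform e he]
  rw [lagrangian, sum_congr rfl hprod, ← mul_sum, mul_left_comm, ← lagrangian]

lemma continuous_lagrangian (H : KGraph V k) : Continuous H.lagrangian := by
  unfold lagrangian
  fun_prop

lemma edges_subset_powersetCard [Fintype V] (H : KGraph V k) : H.edges ⊆ univ.powersetCard k :=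
  fun e he => mem_powersetCard.2 ⟨subset_univ e, H.uniform e he⟩

lemma lagrangian_le_sum_pow [Fintype V] (H : KGraph V k) {x : V → ℝ} (hx : ∀ v, 0 ≤ x v) :
    H.lagrangian x ≤ (∑ v, x v) ^ k :=
  (mul_le_mul_of_nonneg_left (sum_le_sum_of_subset_of_nonneg H.edges_subset_powersetCard
    fun _ _ _ => prod_nonneg fun v _ => hx v) (Nat.cast_nonneg _)).trans
    (factorial_mul_sum_powersetCard_le k fun v _ => hx v)

lemma lagrangian_comap_succAboveEmb {n : ℕ} (H : KGraph (Fin (n + 1)) k) (u : Fin (n + 1))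
    (x : Fin (n + 1) → ℝ) :
    (H.comap u.succAboveEmb).lagrangian (x ∘ u.succAbove) =
      H.lagrangian (Function.update x u 0) := by
  have hrange : ∀ e : Finset (Fin (n + 1)), e ⊆ univ.map u.succAboveEmb ↔ u ∉ e := fun e => by
    rw [map_eq_image, Fin.coe_succAboveEmb, Fin.image_succAbove_univ, subset_compl_singleton]
  have hsum := H.sum_edges_comap u.succAboveEmb fun e => ∏ v ∈ e, x v
  simp only [prod_map, hrange] at hsum
  have hzero : ∀ e ∈ H.edges, ∏ v ∈ e, Function.update x u 0 v =
      if u ∉ e then ∏ v ∈ e, x v else 0 := by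
    intro e _
    split_ifs with hu
    · exact prod_eq_zero hu (Function.update_self ..)
    · exact prod_update_of_notMem hu _ _
  rw [lagrangian, lagrangian, sum_congr rfl hzero, ← sum_filter, ← hsum]
  rfl

end Lagrangian

section PartialDerivative

variable [DecidableEq V]

/-- The partial derivative of the Lagrangian polynomial of `H` in the coordinate `u`. -/
noncomputable def pderiv (H : KGraph V k) (x : V → ℝ) (u : V) : ℝ :=
  k.factorial * ∑ e ∈ H.edges with u ∈ e, ∏ v ∈ e.erase u, x v

lemma lagrangian_update (H : KGraph V k) (x : V → ℝ) (u : V) (t : ℝ) :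
    H.lagrangian (Function.update x u t) = H.lagrangian x + (t - x u) * H.pderiv x u := by
  have hedge : ∀ e ∈ H.edges, ∏ v ∈ e, Function.update x u t v =
      ∏ v ∈ e, x v + if u ∈ e then (t - x u) * ∏ v ∈ e.erase u, x v else 0 := by
    intro e _
    split_ifs with hu
    · rw [prod_update_of_mem hu, sdiff_singleton_eq_erase, ← mul_prod_erase e x hu]
      ring
    · rw [prod_update_of_notMem hu, add_zero]
  rw [lagrangian, sum_congr rfl hedge, sum_add_distrib, ← sum_filter, ← mul_sum, mul_add,
    mul_left_comm, ← lagrangian, ← pderiv]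

end PartialDerivative

variable [Fintype V] {α : ℝ} {H : KGraph V k} {x : V → ℝ}

/-- A nonnegative vector at which the Lagrangian polynomial attains the `α`-spectral radius. -/
structure IsPrincipalVector (H : KGraph V k) (α : ℝ) (x : V → ℝ) : Prop where
  nonneg : ∀ v, 0 ≤ x v
  sum_rpow : ∑ v, x v ^ α = 1
  lagrangian_eq : H.lagrangian x = H.spectralRadius α

lemma spectralRadius_eq_sSup_image (hα : 0 < α) (H : KGraph V k) :
    H.spectralRadius α = sSup (H.lagrangian '' {x | ∑ v, |x v| ^ α = 1}) := by
  have hnorm : ∀ x : V → ℝ, (∑ v, |x v| ^ α) ^ (1 / α) = 1 ↔ ∑ v, |x v| ^ α = 1 := fun x => by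
    rw [one_div, Real.rpow_inv_eq (by positivity) zero_le_one hα.ne', Real.one_rpow]
  simp only [spectralRadius, hnorm, Set.image, Set.mem_ofPred_eq]

lemma lagrangian_le_spectralRadius (hα : 0 < α) (H : KGraph V k) (hx : ∑ v, |x v| ^ α = 1) :
    H.lagrangian x ≤ H.spectralRadius α := by
  rw [spectralRadius_eq_sSup_image hα]
  exact le_csSup ((isCompact_setOf_sum_abs_rpow_eq_one hα).bddAbove_image
    H.continuous_lagrangian.continuousOn) ⟨x, hx, rfl⟩

lemma exists_isPrincipalVector [Nonempty V] (hα : 0 < α) (H : KGraph V k) :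
    ∃ x, H.IsPrincipalVector α x := by
  obtain ⟨x, hx : ∑ v, |x v| ^ α = 1, hmax⟩ :=
    (isCompact_setOf_sum_abs_rpow_eq_one hα).exists_sSup_image_eq
    (nonempty_setOf_sum_abs_rpow_eq_one hα.ne') H.continuous_lagrangian.continuousOn
  rw [← spectralRadius_eq_sSup_image hα] at hmax
  refine ⟨fun v => |x v|, fun v => abs_nonneg _, hx, le_antisymm ?_ ?_⟩
  · exact H.lagrangian_le_spectralRadius hα (by simpa only [abs_abs] using hx)
  · exact hmax.trans_le (H.lagrangian_le_lagrangian_abs x)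

lemma spectralRadius_nonneg [Nonempty V] (hα : 0 < α) (H : KGraph V k) :
    0 ≤ H.spectralRadius α := by
  obtain ⟨x, hx⟩ := H.exists_isPrincipalVector hα
  exact hx.lagrangian_eq ▸ H.lagrangian_nonneg hx.nonneg

lemma lagrangian_le_spectralRadius_mul [Nonempty V] (hα : 0 < α) (H : KGraph V k) (x : V → ℝ) :
    H.lagrangian x ≤ H.spectralRadius α * (∑ v, |x v| ^ α) ^ ((k : ℝ) / α) := by
  obtain ⟨y, hy, hyx⟩ : ∃ y : V → ℝ, ∑ v, |y v| ^ α = 1 ∧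
      x = fun v => (∑ v, |x v| ^ α) ^ (1 / α) * y v := by
    have hnonneg : ∀ v ∈ univ, 0 ≤ |x v| ^ α := fun v _ => by positivity
    rcases (sum_nonneg hnonneg).eq_or_lt with h | h
    · obtain ⟨y, hy⟩ := nonempty_setOf_sum_abs_rpow_eq_one (ι := V) hα.ne'
      refine ⟨y, hy, funext fun v => ?_⟩
      have hv := (sum_eq_zero_iff_of_nonneg hnonneg).1 h.symm v (mem_univ v)
      rw [← h, Real.zero_rpow (one_div_ne_zero hα.ne'), zero_mul]
      exact abs_eq_zero.1 ((Real.rpow_eq_zero (abs_nonneg _) hα.ne').1 hv)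
    · set T := ∑ v, |x v| ^ α
      have hT : 0 < T ^ (1 / α) := Real.rpow_pos_of_pos h _
      refine ⟨fun v => x v / T ^ (1 / α), ?_, funext fun v => (mul_div_cancel₀ _ hT.ne').symm⟩
      simp only [abs_div, abs_of_pos hT, Real.div_rpow (abs_nonneg _) hT.le, ← sum_div]
      rw [← Real.rpow_mul h.le, one_div_mul_cancel hα.ne', Real.rpow_one, div_self h.ne']
  have hT : 0 ≤ ∑ v, |x v| ^ α := by positivity
  calc H.lagrangian x
      = ((∑ v, |x v| ^ α) ^ (1 / α)) ^ k * H.lagrangian y := by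
        conv_lhs => rw [hyx, lagrangian_const_mul]
    _ ≤ ((∑ v, |x v| ^ α) ^ (1 / α)) ^ k * H.spectralRadius α := by
        gcongr
        exact H.lagrangian_le_spectralRadius hα hy
    _ = _ := by rw [← Real.rpow_mul_natCast hT, one_div_mul_eq_div, mul_comm]

lemma factorial_mul_card_edges_le [Nonempty V] (hα : 0 < α) (H : KGraph V k) :
    (k.factorial : ℝ) * #H.edges ≤
      H.spectralRadius α * (Fintype.card V : ℝ) ^ ((k : ℝ) / α) := by
  simpa [lagrangian] using H.lagrangian_le_spectralRadius_mul hα fun _ => 1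

namespace IsPrincipalVector

lemma sum_le_card_rpow (hx : H.IsPrincipalVector α x) (hα : 1 ≤ α) :
    ∑ v, x v ≤ (Fintype.card V : ℝ) ^ (1 - 1 / α) := by
  have hα0 : 0 < α := one_pos.trans_le hα
  have hpow := Real.rpow_sum_le_const_mul_sum_rpow_of_nonneg univ hα fun v _ => hx.nonneg v
  rw [hx.sum_rpow, mul_one, card_univ,
    ← Real.le_rpow_inv_iff_of_pos (sum_nonneg fun v _ => hx.nonneg v) (by positivity) hα0,
    ← Real.rpow_mul (Nat.cast_nonneg _)] at hpow
  rwa [show 1 - 1 / α = (α - 1) * α⁻¹ by field_simp]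

/-- The eigenvalue equation, obtained by perturbing the single coordinate `u`. -/
lemma pderiv_eq [DecidableEq V] (hx : H.IsPrincipalVector α x) (hα : 1 < α) (u : V) :
    H.pderiv x u = k * H.spectralRadius α * x u ^ (α - 1) := by
  have : Nonempty V := ⟨u⟩
  have hα0 : 0 < α := one_pos.trans hα
  set norm : ℝ → ℝ := fun t => 1 - x u ^ α + |t| ^ α
  have hnorm : ∀ t, ∑ v, |Function.update x u t v| ^ α = norm t := by
    intro t
    have hrest : ∀ v ∈ univ.erase u, |Function.update x u t v| ^ α = x v ^ α := fun v hv => by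
      rw [Function.update_of_ne (ne_of_mem_erase hv), abs_of_nonneg (hx.nonneg v)]
    have hsum := hx.sum_rpow
    rw [← add_sum_erase _ _ (mem_univ u)] at hsum ⊢
    rw [sum_congr rfl hrest, Function.update_self]
    linarith
  have hnorm1 : norm (x u) = 1 := by simp [norm, abs_of_nonneg (hx.nonneg u)]
  set gap : ℝ → ℝ := fun t => H.spectralRadius α + (t - x u) * H.pderiv x u -
    H.spectralRadius α * norm t ^ ((k : ℝ) / α)
  have hmax : IsLocalMax gap (x u) := by
    refine .of_forall fun t => ?_
    have h := H.lagrangian_le_spectralRadius_mul hα0 (Function.update x u t)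
    rw [lagrangian_update, hnorm, hx.lagrangian_eq] at h
    simpa only [gap, hnorm1, sub_self, zero_mul, add_zero, Real.one_rpow, mul_one,
      sub_nonpos] using h
  have hderiv : HasDerivAt gap (H.pderiv x u - H.spectralRadius α * (k * x u ^ (α - 1)))
      (x u) := by
    have hderiv_norm : HasDerivAt norm (α * x u ^ (α - 1)) (x u) := by
      refine ((hasDerivAt_abs_rpow (x u) hα).const_add (1 - x u ^ α)).congr_deriv ?_
      rw [abs_of_nonneg (hx.nonneg u), mul_assoc,
        ← Real.rpow_add_one' (hx.nonneg u) (by linarith)]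
      ring_nf
    have h := ((((hasDerivAt_id (x u)).sub_const (x u)).mul_const (H.pderiv x u)).const_add
      (H.spectralRadius α)).sub ((hderiv_norm.rpow_const (p := (k : ℝ) / α)
        (.inl (by simp [hnorm1]))).const_mul (H.spectralRadius α))
    refine h.congr_deriv ?_
    rw [hnorm1, Real.one_rpow]
    field_simp
  linarith [hmax.hasDerivAt_eq_zero hderiv]

lemma spectralRadius_le_add_comap {n : ℕ} [NeZero n] {H : KGraph (Fin (n + 1)) k}
    {x : Fin (n + 1) → ℝ} (hx : H.IsPrincipalVector α x) (hα : 1 < α) (u : Fin (n + 1)) :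
    H.spectralRadius α ≤ (H.comap u.succAboveEmb).spectralRadius α +
      H.spectralRadius α * (x u ^ α * ((k - k / α) + k * (k / α) * x u ^ α)) := by
  have hα0 : 0 < α := one_pos.trans hα
  have hz : 0 ≤ x u ^ α := Real.rpow_nonneg (hx.nonneg u) _
  have hz1 : x u ^ α ≤ 1 := Real.rpow_le_one (hx.nonneg u)
    (le_one_of_sum_rpow_eq_one hα0 hx.nonneg hx.sum_rpow u) hα0.le
  have hr : 0 ≤ (k : ℝ) / α := by positivity
  have hsum : ∑ i, |(x ∘ u.succAbove) i| ^ α = 1 - x u ^ α := by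
    have h := hx.sum_rpow
    rw [Fin.sum_univ_succAbove _ u] at h
    simp only [Function.comp_apply, abs_of_nonneg (hx.nonneg _)]
    linarith
  have hpow : x u ^ (α - 1) * x u = x u ^ α := by
    rw [← Real.rpow_add_one' (hx.nonneg u) (by linarith), sub_add_cancel]
  have hdelete : H.spectralRadius α * (1 - k * x u ^ α) ≤
      (H.comap u.succAboveEmb).spectralRadius α * (1 - x u ^ α) ^ ((k : ℝ) / α) := by
    have h := (H.comap u.succAboveEmb).lagrangian_le_spectralRadius_mul hα0 (x ∘ u.succAbove)
    rw [lagrangian_comap_succAboveEmb, lagrangian_update, hx.lagrangian_eq, hx.pderiv_eq hα,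
      hsum] at h
    rw [← hpow] at h ⊢
    linarith
  have hle : H.spectralRadius α * (1 - k * x u ^ α) * (1 + k / α * x u ^ α) ≤
      (H.comap u.succAboveEmb).spectralRadius α := by
    refine (mul_le_mul_of_nonneg_right hdelete (by positivity)).trans ?_
    rw [mul_assoc]
    exact mul_le_of_le_one_right (spectralRadius_nonneg hα0 _)
      (one_sub_rpow_mul_one_add_le_one hz1 hr)
  linarith

end IsPrincipalVector

end KGraph

section MaxSpectralRadius

variable {k n : ℕ} {α : ℝ} {𝓖 𝓖' : Set (KGraph (Fin n) k)} {H : KGraph (Fin n) k}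

lemma spectralRadius_le_maxSpectralRadius (hH : H ∈ 𝓖) :
    H.spectralRadius α ≤ maxSpectralRadius α 𝓖 :=
  le_csSup (𝓖.toFinite.image _).bddAbove ⟨H, hH, rfl⟩

lemma maxSpectralRadius_nonneg [NeZero n] (hα : 0 < α) (𝓖 : Set (KGraph (Fin n) k)) :
    0 ≤ maxSpectralRadius α 𝓖 := by
  refine Real.sSup_nonneg ?_
  rintro _ ⟨H, -, rfl⟩
  exact H.spectralRadius_nonneg hα

lemma exists_notMem_spectralRadius_eq_maxSpectralRadius [NeZero n] (hα : 0 < α)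
    (h : maxSpectralRadius α 𝓖' < maxSpectralRadius α 𝓖) :
    ∃ H ∈ 𝓖, H ∉ 𝓖' ∧ H.spectralRadius α = maxSpectralRadius α 𝓖 := by
  have hne : 𝓖.Nonempty := by
    refine Set.nonempty_iff_ne_empty.2 fun hempty => ?_
    have hzero : maxSpectralRadius α 𝓖 = 0 := by simp [maxSpectralRadius, hempty]
    exact (hzero ▸ h).not_ge (maxSpectralRadius_nonneg hα 𝓖')
  obtain ⟨H, hH, hmax : H.spectralRadius α = maxSpectralRadius α 𝓖⟩ :=
    (hne.image (KGraph.spectralRadius α)).csSup_mem (𝓖.toFinite.image _)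
  exact ⟨H, hH, fun hH' => (spectralRadius_le_maxSpectralRadius hH').not_gt (hmax ▸ h), hmax⟩

lemma eventually_forall_le_maxSpectralRadius {𝓖 𝓖' : ∀ n, Set (KGraph (Fin n) k)} {f : ℕ → ℝ}
    (hα : 0 < α) (hf : ∀ n, 0 < f n) (hsum : ¬ Summable f)
    (h : ∀ᶠ n in atTop, ∀ H ∈ 𝓖 (n + 1), H ∉ 𝓖' (n + 1) →
      H.spectralRadius α = maxSpectralRadius α (𝓖 (n + 1)) →
        maxSpectralRadius α (𝓖 (n + 1)) - maxSpectralRadius α (𝓖' (n + 1)) + f n ≤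
          maxSpectralRadius α (𝓖 n) - maxSpectralRadius α (𝓖' n)) :
    ∀ᶠ n in atTop, ∀ H ∈ 𝓖 n, H.spectralRadius α ≤ maxSpectralRadius α (𝓖' n) ∧
      (H.spectralRadius α = maxSpectralRadius α (𝓖' n) → H ∈ 𝓖' n) := by
  have hgap : ∀ᶠ n in atTop, maxSpectralRadius α (𝓖 n) - maxSpectralRadius α (𝓖' n) ≤ 0 := by
    refine eventually_nonpos_of_decreasing_while_pos (fun n => (hf n).le) hsum ?_
    filter_upwards [h] with n hn hpos
    obtain ⟨H, hH, hnot, hmax⟩ :=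
      exists_notMem_spectralRadius_eq_maxSpectralRadius hα (sub_pos.1 hpos)
    exact hn H hH hnot hmax
  have hgap_succ := (tendsto_add_atTop_nat 1).eventually hgap
  rw [← map_add_atTop_eq_nat 1, eventually_map]
  filter_upwards [h, hgap, hgap_succ] with n hn hgap hgap_succ H hH
  have hle := spectralRadius_le_maxSpectralRadius (α := α) hH
  refine ⟨hle.trans (sub_nonpos.1 hgap_succ), fun heq => ?_⟩
  by_contra hnot
  linarith [hf n, hn H hH hnot (by linarith)]

end MaxSpectralRadius

lemma natCast_rpow_one_sub_one_div_pow (n k : ℕ) (α : ℝ) :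
    ((n : ℝ) ^ (1 - 1 / α)) ^ k = (n : ℝ) ^ ((k : ℝ) - k / α) := by
  rw [← Real.rpow_mul_natCast n.cast_nonneg]
  ring_nf

namespace KFamily

variable {k : ℕ} {𝓕 : KFamily k} {α : ℝ}

/-- The maximum `α`-spectral radius of an `𝓕`-free `k`-graph on `n` vertices, the spectral
analogue of the Turán number `ex(n, 𝓕)`. -/
noncomputable def spectralEx (𝓕 : KFamily k) (α : ℝ) (n : ℕ) : ℝ :=
  maxSpectralRadius α {G : KGraph (Fin n) k | G.IsFree 𝓕}

lemma lagrangian_mul_pow_le {V : Type*} [Fintype V] {H : KGraph V k} (hH : H.IsFree 𝓕) {m : ℕ}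
    (hm : k ≤ m) {x : V → ℝ} (hx : ∀ v, 0 ≤ x v) (hx1 : ∀ v, x v ≤ 1) (hS : (m : ℝ) ≤ ∑ v, x v) :
    H.lagrangian x * (∑ v, x v - m) ^ (m - k) ≤ 𝓕.ex m / m.choose k * (∑ v, x v) ^ m := by
  classical
  set S := ∑ v, x v
  set extensions : Finset V → ℝ := fun e => ∑ t ∈ (univ \ e).powersetCard (m - k), ∏ v ∈ t, x v
  have hext : ∀ e ∈ H.edges, (S - m) ^ (m - k) ≤ (m - k).factorial * extensions e := by
    intro e he
    have hsplit : ∑ v ∈ univ \ e, x v + ∑ v ∈ e, x v = S := sum_sdiff (subset_univ e)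
    have hle : ∑ v ∈ e, x v ≤ k := by
      simpa [H.uniform e he] using sum_le_card_nsmul e x 1 fun v _ => hx1 v
    have hmk : ((m - k : ℕ) : ℝ) = m - k := Nat.cast_sub hm
    refine (pow_le_pow_left₀ (by linarith) ?_ _).trans (sub_pow_le_factorial_mul_sum_powersetCard
      (m - k) (fun v _ => hx v) (fun v _ => hx1 v) ?_) <;> linarith
  have hfact : (m.factorial : ℝ) = m.choose k * k.factorial * (m - k).factorial :=
    mod_cast (Nat.choose_mul_factorial_mul_factorial hm).symm
  have hchoose : (0 : ℝ) < m.choose k := mod_cast Nat.choose_pos hm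
  rw [div_mul_eq_mul_div, le_div_iff₀ hchoose]
  calc H.lagrangian x * (S - m) ^ (m - k) * m.choose k
      = m.choose k * k.factorial * ∑ e ∈ H.edges, (∏ v ∈ e, x v) * (S - m) ^ (m - k) := by
        rw [KGraph.lagrangian, ← sum_mul]
        ring
    _ ≤ m.choose k * k.factorial *
          ∑ e ∈ H.edges, (∏ v ∈ e, x v) * ((m - k).factorial * extensions e) := by
        gcongr with e he
        · exact prod_nonneg fun v _ => hx v
        · exact hext e he
    _ = m.factorial * ∑ e ∈ H.edges, (∏ v ∈ e, x v) * extensions e := by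
        simp_rw [mul_left_comm _ ((m - k).factorial : ℝ)]
        rw [← mul_sum, hfact, mul_assoc _ ((m - k).factorial : ℝ)]
    _ ≤ m.factorial * (𝓕.ex m * ∑ M ∈ univ.powersetCard m, ∏ v ∈ M, x v) := by
        gcongr
        exact sum_edges_mul_sum_powersetCard_le hH hm hx
    _ = 𝓕.ex m * (m.factorial * ∑ M ∈ univ.powersetCard m, ∏ v ∈ M, x v) := mul_left_comm _ _ _
    _ ≤ 𝓕.ex m * S ^ m := by
        gcongr
        exact factorial_mul_sum_powersetCard_le m fun v _ => hx v

lemma eventually_lagrangian_le {q : ℝ} (hq : 𝓕.density < q) :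
    ∀ᶠ S : ℝ in atTop, ∀ n : ℕ, ∀ H : KGraph (Fin n) k, H.IsFree 𝓕 → ∀ x : Fin n → ℝ,
      (∀ v, 0 ≤ x v) → (∀ v, x v ≤ 1) → ∑ v, x v = S → H.lagrangian x ≤ q * S ^ k := by
  obtain ⟨m, hmq, hm⟩ :=
    ((𝓕.tendsto_ex_div_choose.eventually_lt_const hq).and (eventually_ge_atTop k)).exists
  have hlim : Tendsto (fun S : ℝ => q * (1 - m / S) ^ (m - k)) atTop (𝓝 q) := by
    simpa using (((tendsto_const_nhds (x := (m : ℝ))).div_atTop tendsto_id).const_sub 1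
      |>.pow (m - k)).const_mul q
  filter_upwards [hlim.eventually_const_lt hmq, eventually_gt_atTop (m : ℝ)]
    with S hSq hmS n H hH x hx hx1 hsum
  have hS : 0 < S := m.cast_nonneg.trans_lt hmS
  refine le_of_mul_le_mul_right ?_ (pow_pos (sub_pos.2 hmS) (m - k))
  calc H.lagrangian x * (S - m) ^ (m - k)
      ≤ 𝓕.ex m / m.choose k * S ^ m := by
        simpa only [hsum] using lagrangian_mul_pow_le hH hm hx hx1 (hsum ▸ hmS.le)
    _ ≤ q * (1 - m / S) ^ (m - k) * S ^ m := by gcongr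
    _ = q * S ^ k * (S - m) ^ (m - k) := by
        have hSm : S - m = (1 - m / S) * S := by field_simp
        rw [hSm, mul_pow, ← Nat.add_sub_cancel' hm, pow_add, Nat.add_sub_cancel_left]
        ring

lemma eventually_spectralEx_le (hk : k ≠ 0) (hα : 1 < α) {q : ℝ} (hq : 𝓕.density < q) :
    ∀ᶠ n : ℕ in atTop, 𝓕.spectralEx α n ≤ q * ((n : ℝ) ^ (1 - 1 / α)) ^ k := by
  have hα0 : 0 < α := one_pos.trans hα
  have hq0 : 0 < q := 𝓕.density_nonneg.trans_lt hq
  have hexp : 0 < 1 - 1 / α := by rw [sub_pos, div_lt_one hα0]; exact hα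
  obtain ⟨T, hT⟩ := eventually_atTop.1 (eventually_lagrangian_le hq)
  have hgrow : Tendsto (fun n : ℕ => q * ((n : ℝ) ^ (1 - 1 / α)) ^ k) atTop atTop :=
    ((tendsto_pow_atTop hk).comp ((tendsto_rpow_atTop hexp).comp
      tendsto_natCast_atTop_atTop)).const_mul_atTop hq0
  filter_upwards [hgrow.eventually_ge_atTop (T ^ k), eventually_ne_atTop 0] with n hTn hn
  have : NeZero n := ⟨hn⟩
  refine Real.sSup_le ?_ (by positivity)
  rintro _ ⟨H, hH, rfl⟩
  obtain ⟨x, hx⟩ := H.exists_isPrincipalVector hα0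
  rw [← hx.lagrangian_eq]
  have hS0 : 0 ≤ ∑ v, x v := sum_nonneg fun v _ => hx.nonneg v
  have hSn : ∑ v, x v ≤ (n : ℝ) ^ (1 - 1 / α) := by
    simpa using hx.sum_le_card_rpow hα.le
  rcases le_total T (∑ v, x v) with hTS | hST
  · calc H.lagrangian x ≤ q * (∑ v, x v) ^ k := hT _ hTS n H hH x hx.nonneg
          (le_one_of_sum_rpow_eq_one hα0 hx.nonneg hx.sum_rpow) rfl
      _ ≤ q * ((n : ℝ) ^ (1 - 1 / α)) ^ k := by gcongr
  · calc H.lagrangian x ≤ (∑ v, x v) ^ k := H.lagrangian_le_sum_pow hx.nonneg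
      _ ≤ T ^ k := by gcongr
      _ ≤ _ := hTn

lemma factorial_mul_ex_le_spectralEx {n : ℕ} [NeZero n] (hα : 0 < α) :
    k.factorial * (𝓕.ex n : ℝ) ≤ 𝓕.spectralEx α n * (n : ℝ) ^ ((k : ℝ) / α) := by
  rcases 𝓕.ex_eq_zero_or_exists_card_edges_eq n with h | ⟨G, hG, hGn⟩
  · rw [h, Nat.cast_zero, mul_zero]
    exact mul_nonneg (maxSpectralRadius_nonneg hα _) (by positivity)
  · rw [← hGn]
    refine (G.factorial_mul_card_edges_le hα).trans ?_
    rw [Fintype.card_fin]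
    exact mul_le_mul_of_nonneg_right (spectralRadius_le_maxSpectralRadius hG) (by positivity)

lemma tendsto_spectralEx_div (𝓕 : KFamily k) (hk : k ≠ 0) (hα : 1 < α) :
    Tendsto (fun n : ℕ => 𝓕.spectralEx α n / (n : ℝ) ^ ((k : ℝ) - k / α)) atTop
      (𝓝 𝓕.density) := by
  refine tendsto_order.2 ⟨fun q hq => ?_, fun q hq => ?_⟩
  · filter_upwards [𝓕.tendsto_factorial_mul_ex_div_pow.eventually_const_lt hq,
      eventually_ne_atTop 0] with n hqn hn
    have : NeZero n := ⟨hn⟩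
    have hn0 : (0 : ℝ) < n := Nat.cast_pos.2 (Nat.pos_of_ne_zero hn)
    refine hqn.trans_le ?_
    rw [Real.rpow_sub hn0, Real.rpow_natCast, div_div_eq_mul_div]
    exact div_le_div_of_nonneg_right (factorial_mul_ex_le_spectralEx (one_pos.trans hα))
      (by positivity)
  · obtain ⟨q', hq', hqq'⟩ := exists_between hq
    filter_upwards [eventually_spectralEx_le hk hα hq', eventually_gt_atTop 0] with n hn hn0
    rw [natCast_rpow_one_sub_one_div_pow] at hn
    have hpos : (0 : ℝ) < (n : ℝ) ^ ((k : ℝ) - k / α) := by positivity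
    exact ((div_le_iff₀ hpos).2 hn).trans_lt hqq'

end KFamily

namespace KGraph

variable {V : Type*} [Fintype V] {k : ℕ} {α a : ℝ} {x : V → ℝ}

lemma sum_prod_erase_sub_pow_le [DecidableEq V] (H : KGraph V (k + 1)) (ha : 0 ≤ a)
    (hxa : ∀ v, a ≤ x v) (u : V) :
    ∑ e ∈ H.edges with u ∈ e, (∏ v ∈ e.erase u, x v - a ^ k) ≤
      ∑ t ∈ univ.powersetCard k, (∏ v ∈ t, x v - a ^ k) := by
  rw [← sum_image (s := {e ∈ H.edges | u ∈ e}) (g := fun e => e.erase u)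
    (f := fun t => ∏ v ∈ t, x v - a ^ k)]
  · refine sum_le_sum_of_subset_of_nonneg (image_subset_iff.2 fun e he => ?_) fun t ht _ => ?_
    · obtain ⟨he, hue⟩ := mem_filter.1 he
      exact mem_powersetCard.2 ⟨subset_univ _, by rw [card_erase_of_mem hue, H.uniform e he]; rfl⟩
    · rw [sub_nonneg, ← (mem_powersetCard.1 ht).2]
      rw [← prod_const]
      exact prod_le_prod (fun _ _ => ha) fun v _ => hxa v
  · intro e he f hf hef
    rw [← insert_erase (mem_filter.1 he).2, ← insert_erase (mem_filter.1 hf).2]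
    exact congrArg (insert u) hef

lemma pderiv_le [DecidableEq V] (H : KGraph V (k + 1)) (ha : 0 ≤ a) (hxa : ∀ v, a ≤ x v) (u : V) :
    H.pderiv x u ≤ (k + 1) * ((∑ v, x v) ^ k -
      k.factorial * ((Fintype.card V).choose k - H.degree u) * a ^ k) := by
  have hsum := H.sum_prod_erase_sub_pow_le ha hxa u
  simp only [sum_sub_distrib, sum_const, nsmul_eq_mul, card_powersetCard, card_univ,
    ← degree.eq_1] at hsum
  have hpow := factorial_mul_sum_powersetCard_le (s := univ) k fun v _ => ha.trans (hxa v)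
  have hmul := mul_le_mul_of_nonneg_left hsum (Nat.cast_nonneg (α := ℝ) k.factorial)
  rw [pderiv, Nat.factorial_succ, Nat.cast_mul, mul_assoc, Nat.cast_succ]
  gcongr
  linarith

namespace IsPrincipalVector

lemma spectralRadius_mul_rpow_le [DecidableEq V] {H : KGraph V (k + 1)}
    (hx : H.IsPrincipalVector α x) (hα : 1 < α) (ha : 0 ≤ a) (hxa : ∀ v, a ≤ x v) (u : V) :
    H.spectralRadius α * a ^ (α - 1) ≤
      (∑ v, x v) ^ k - k.factorial * ((Fintype.card V).choose k - H.degree u) * a ^ k := by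
  have : Nonempty V := ⟨u⟩
  have hderiv := H.pderiv_le ha hxa u
  rw [hx.pderiv_eq hα, Nat.cast_succ, mul_assoc] at hderiv
  refine le_trans ?_ (le_of_mul_le_mul_left hderiv k.cast_add_one_pos)
  have hle : a ^ (α - 1) ≤ x u ^ (α - 1) := Real.rpow_le_rpow ha (hxa u) (sub_pos.2 hα).le
  exact mul_le_mul_of_nonneg_left hle (H.spectralRadius_nonneg (one_pos.trans hα))

lemma spectralRadius_div_mul_rpow_le {n : ℕ} {H : KGraph (Fin n) (k + 1)} {x : Fin n → ℝ}
    (hx : H.IsPrincipalVector α x) (hα : 1 < α) {b d : ℝ} (hb : 0 ≤ b)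
    (hxb : ∀ v, b / n ≤ x v ^ α) {u : Fin n} (hu : H.degree u ≤ d * n.choose k) :
    H.spectralRadius α / (n : ℝ) ^ (((k + 1 : ℕ) : ℝ) - (k + 1 : ℕ) / α) * b ^ (1 - 1 / α) ≤
      1 - (1 - d) * (k.factorial * n.choose k / (n : ℝ) ^ k) * b ^ ((k : ℝ) / α) := by
  have hα0 : 0 < α := one_pos.trans hα
  have hn : (0 : ℝ) < n := Nat.cast_pos.2 u.pos
  set N := (n : ℝ) ^ (1 - 1 / α) with hN
  set a := (b / n) ^ (1 / α) with ha_def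
  have hN0 : 0 < N := Real.rpow_pos_of_pos hn _
  have ha : 0 ≤ a := by positivity
  have hxa : ∀ v, a ≤ x v := fun v => by
    rw [ha_def, one_div]
    exact (Real.rpow_inv_le_iff_of_pos (by positivity) (hx.nonneg v) hα0).2 (hxb v)
  have haN : a ^ (α - 1) * N = b ^ (1 - 1 / α) := by
    rw [ha_def, ← Real.rpow_mul (by positivity), show 1 / α * (α - 1) = 1 - 1 / α by field_simp,
      Real.div_rpow hb hn.le, ← hN, div_mul_cancel₀ _ hN0.ne']
  have hak : b ^ ((k : ℝ) / α) * N ^ k = n ^ k * a ^ k := by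
    have hna : n * a = b ^ (1 / α) * N := by
      rw [ha_def, hN, Real.div_rpow hb hn.le, Real.rpow_sub hn, Real.rpow_one]
      ring
    rw [← mul_pow, hna, mul_pow, ← Real.rpow_mul_natCast hb, one_div_mul_eq_div]
  have hsum : ∑ v, x v ≤ N := by
    simpa only [Fintype.card_fin] using hx.sum_le_card_rpow hα.le
  have hmain : H.spectralRadius α * a ^ (α - 1) ≤
      N ^ k - (1 - d) * (k.factorial * n.choose k) * a ^ k := by
    refine (hx.spectralRadius_mul_rpow_le hα ha hxa u).trans ?_
    rw [Fintype.card_fin]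
    have hpow : (∑ v, x v) ^ k ≤ N ^ k :=
      pow_le_pow_left₀ (sum_nonneg fun v _ => hx.nonneg v) hsum k
    have hdeg : k.factorial * a ^ k * H.degree u ≤ k.factorial * a ^ k * (d * n.choose k) :=
      mul_le_mul_of_nonneg_left hu (by positivity)
    linarith
  rw [← natCast_rpow_one_sub_one_div_pow, ← hN, ← haN]
  refine le_of_mul_le_mul_right ?_ (pow_pos hN0 k)
  calc _ = H.spectralRadius α * a ^ (α - 1) := by rw [pow_succ]; field_simp
    _ ≤ N ^ k - (1 - d) * (k.factorial * n.choose k) * a ^ k := hmain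
    _ = N ^ k - (1 - d) * (k.factorial * n.choose k / n ^ k) * (n ^ k * a ^ k) := by field_simp
    _ = _ := by rw [← hak]; ring

end IsPrincipalVector

end KGraph

lemma one_sub_mul_rpow_lt_mul_rpow {k : ℕ} {α b d q : ℝ} (hα : 1 < α) (hb : 0 < b) (hb1 : b ≤ 1)
    (hd : 0 ≤ d) (hq : 0 ≤ q) (hq1 : q ≤ 1) (h : (k + 1) * (1 - b) < q - d) :
    1 - (1 - d) * b ^ ((k : ℝ) / α) < q * b ^ (1 - 1 / α) := by
  have hk0 : 0 ≤ k * (1 - b) := mul_nonneg k.cast_nonneg (sub_nonneg.2 hb1)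
  have hbernoulli : 1 - k * (1 - b) ≤ b ^ ((k : ℝ) / α) :=
    calc 1 - k * (1 - b) = 1 + k * (b - 1) := by ring
      _ ≤ b ^ k := one_add_mul_sub_le_pow (by linarith) k
      _ = b ^ (k : ℝ) := (Real.rpow_natCast b k).symm
      _ ≤ b ^ ((k : ℝ) / α) :=
        Real.rpow_le_rpow_of_exponent_ge hb hb1 (div_le_self k.cast_nonneg hα.le)
  have hroot : b ≤ b ^ (1 - 1 / α) :=
    Real.self_le_rpow_of_le_one hb.le hb1 (sub_le_self 1
      (one_div_pos.2 (one_pos.trans hα)).le)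
  have hd1 : d ≤ 1 := by linarith [mul_nonneg (k.cast_add_one_pos (α := ℝ)).le (sub_nonneg.2 hb1)]
  calc 1 - (1 - d) * b ^ ((k : ℝ) / α)
      ≤ 1 - (1 - d) * (1 - k * (1 - b)) :=
        sub_le_sub_left (mul_le_mul_of_nonneg_left hbernoulli (sub_nonneg.2 hd1)) 1
    _ ≤ d + k * (1 - b) := by linarith [mul_nonneg hd hk0]
    _ < q - (1 - b) := by linarith
    _ ≤ q - q * (1 - b) := by linarith [mul_le_of_le_one_left (sub_nonneg.2 hb1) hq1]
    _ = q * b := by ring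
    _ ≤ q * b ^ (1 - 1 / α) := mul_le_mul_of_nonneg_left hroot hq

lemma exists_pos_lt_one_sub_mul_rpow_lt_mul_rpow {k : ℕ} {α d q s : ℝ} (hα : 1 < α) (hd : 0 ≤ d)
    (hdq : d < q) (hq1 : q ≤ 1) (hs : 1 - s < (q - d) / (k + 1)) :
    ∃ b, 0 < b ∧ b < s ∧ 1 - (1 - d) * b ^ ((k : ℝ) / α) < q * b ^ (1 - 1 / α) := by
  have hk : (0 : ℝ) < k + 1 := k.cast_add_one_pos
  have hpos : 0 < (q - d) / (k + 1) := div_pos (sub_pos.2 hdq) hk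
  have hle : (q - d) / (k + 1) ≤ 1 := by
    rw [div_le_one hk]
    linarith [k.cast_nonneg (α := ℝ)]
  obtain ⟨b, hb, hbs⟩ : ∃ b, 1 - (q - d) / (k + 1) < b ∧ b < min 1 s :=
    exists_between (lt_min (by linarith) (by linarith))
  obtain ⟨hb1, hbs⟩ := lt_min_iff.1 hbs
  have hb0 : 0 < b := by linarith
  refine ⟨b, hb0, hbs, one_sub_mul_rpow_lt_mul_rpow hα hb0 hb1.le hd (hd.trans hdq.le) hq1 ?_⟩
  rw [← lt_div_iff₀' hk]
  linarith

namespace KFamily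

variable {k : ℕ} {α : ℝ}

lemma density_le_one (𝓕 : KFamily k) : 𝓕.density ≤ 1 := by
  refine le_of_tendsto 𝓕.tendsto_ex_div_choose (.of_forall fun n => ?_)
  refine div_le_one_of_le₀ (Nat.cast_le.2 ?_) (Nat.cast_nonneg _)
  rcases 𝓕.ex_eq_zero_or_exists_card_edges_eq n with h | ⟨G, -, hG⟩
  · exact h ▸ Nat.zero_le _
  · rw [← hG]
    exact (card_le_card G.edges_subset_powersetCard).trans_eq (by simp)

lemma exists_degree_lt_of_notMem_largeMinDegree {𝓕 : KFamily k} {ε : ℝ} {n : ℕ} [NeZero n]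
    {H : KGraph (Fin n) k} (hH : H.IsFree 𝓕) (hnot : H ∉ 𝓕.largeMinDegree ε n) :
    ∃ u, H.degree u < (1 - ε) * 𝓕.density * n.choose (k - 1) := by
  obtain ⟨u, hu⟩ := exists_eq_ciInf_of_finite (f := H.degree)
  refine ⟨u, ?_⟩
  by_contra! h
  exact hnot ⟨hH, by rwa [KGraph.minDegree, ← hu]⟩

lemma eventually_exists_rpow_lt {𝓕 : KFamily (k + 1)} (hα : 1 < α) {b d : ℝ} (hb : 0 ≤ b)
    (hbd : 1 - (1 - d) * b ^ ((k : ℝ) / α) < 𝓕.density * b ^ (1 - 1 / α)) :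
    ∀ᶠ n : ℕ in atTop, ∀ H : KGraph (Fin n) (k + 1), H.spectralRadius α = 𝓕.spectralEx α n →
      (∃ u, H.degree u ≤ d * n.choose k) → ∀ x, H.IsPrincipalVector α x →
        ∃ u, x u ^ α < b / n := by
  have hlow := (𝓕.tendsto_spectralEx_div k.succ_ne_zero hα).mul_const (b ^ (1 - 1 / α))
  have hup : Tendsto (fun n : ℕ => 1 - (1 - d) * (k.factorial * n.choose k / (n : ℝ) ^ k) *
      b ^ ((k : ℝ) / α)) atTop (𝓝 (1 - (1 - d) * b ^ ((k : ℝ) / α))) := by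
    simpa only [mul_one] using (((tendsto_factorial_mul_choose_div_pow k).const_mul
      (1 - d)).mul_const (b ^ ((k : ℝ) / α))).const_sub 1
  filter_upwards [hup.eventually_lt hlow hbd] with n hn H hH ⟨u, hu⟩ x hx
  by_contra! hxb
  exact hn.not_ge (hH ▸ hx.spectralRadius_div_mul_rpow_le hα hb hxb hu)

lemma exists_eventually_spectralEx_succ_add_le {𝓕 : KFamily k} (hk : k ≠ 0) (hα : 1 < α)
    (hπ : 0 < 𝓕.density) {b s : ℝ} (hb : 0 ≤ b) (hbs : b < s) :
    ∃ c > 0, ∀ᶠ n : ℕ in atTop, ∀ H : KGraph (Fin (n + 1)) k, H.IsFree 𝓕 →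
      H.spectralRadius α = 𝓕.spectralEx α (n + 1) →
      ∀ x, H.IsPrincipalVector α x → ∀ u, x u ^ α < b / ((n + 1 : ℕ) : ℝ) →
        𝓕.spectralEx α (n + 1) + c * ((n + 1 : ℕ) : ℝ) ^ ((k : ℝ) - k / α - 1) ≤
          𝓕.spectralEx α n + ((k : ℝ) - k / α) * s * 𝓕.density *
            ((n + 1 : ℕ) : ℝ) ^ ((k : ℝ) - k / α - 1) := by
  have hα0 : 0 < α := one_pos.trans hα
  set p : ℝ := k - k / α with hp_def
  have hp : 0 < p := sub_pos.2 (div_lt_self (Nat.cast_pos.2 (Nat.pos_of_ne_zero hk)) hα)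
  set loss : ℕ → ℝ := fun n => 𝓕.spectralEx α n / (n : ℝ) ^ p * (b * (p + k * (k / α) * (b / n)))
  have hloss : Tendsto loss atTop (𝓝 (𝓕.density * (b * p))) := by
    have hbn : Tendsto (fun n : ℕ => b / (n : ℝ)) atTop (𝓝 0) :=
      tendsto_const_nhds.div_atTop tendsto_natCast_atTop_atTop
    simpa only [mul_zero, add_zero] using (𝓕.tendsto_spectralEx_div hk hα).mul
      (((hbn.const_mul (k * (k / α) : ℝ)).const_add p).const_mul b)
  obtain ⟨r, hr, hrs⟩ := exists_between
    (show 𝓕.density * (b * p) < p * s * 𝓕.density by nlinarith [mul_pos hp hπ])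
  refine ⟨p * s * 𝓕.density - r, sub_pos.2 hrs, ?_⟩
  filter_upwards [(tendsto_add_atTop_nat 1).eventually (hloss.eventually_lt_const hr),
    eventually_ne_atTop 0] with n hn hn0 H hH hHs x hx u hu
  have : NeZero n := ⟨hn0⟩
  have hm : (0 : ℝ) < (n + 1 : ℕ) := by positivity
  have hcomap : (H.comap u.succAboveEmb).spectralRadius α ≤ 𝓕.spectralEx α n :=
    spectralRadius_le_maxSpectralRadius (hH.comap _)
  have hdelete := hx.spectralRadius_le_add_comap hα u
  rw [hHs, ← hp_def] at hdelete
  have hxu : 0 ≤ x u ^ α := Real.rpow_nonneg (hx.nonneg u) _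
  have hl : 0 ≤ 𝓕.spectralEx α (n + 1) := maxSpectralRadius_nonneg hα0 _
  have hle : 𝓕.spectralEx α (n + 1) * (x u ^ α * (p + k * (k / α) * x u ^ α)) ≤
      r * ((n + 1 : ℕ) : ℝ) ^ (p - 1) := by
    calc 𝓕.spectralEx α (n + 1) * (x u ^ α * (p + k * (k / α) * x u ^ α))
        ≤ 𝓕.spectralEx α (n + 1) * (b / (n + 1 : ℕ) *
            (p + k * (k / α) * (b / (n + 1 : ℕ)))) := by gcongr
      _ = loss (n + 1) * ((n + 1 : ℕ) : ℝ) ^ (p - 1) := by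
        simp only [loss]
        rw [Real.rpow_sub_one hm.ne']
        field_simp
      _ ≤ r * ((n + 1 : ℕ) : ℝ) ^ (p - 1) := by gcongr
  linarith

lemma exists_eventually_spectralEx_succ_add_le_of_notMem {𝓕 : KFamily k} (hk : k ≠ 0)
    (hα : 1 < α) {ε ε' : ℝ} (hε : 0 < ε) (hε' : ε' < ε * 𝓕.density / k) :
    ∃ c > 0, ∀ᶠ n : ℕ in atTop, ∀ H : KGraph (Fin (n + 1)) k, H.IsFree 𝓕 →
      H.spectralRadius α = 𝓕.spectralEx α (n + 1) → H ∉ 𝓕.largeMinDegree ε (n + 1) →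
        𝓕.spectralEx α (n + 1) + c * ((n + 1 : ℕ) : ℝ) ^ ((k : ℝ) - k / α - 1) ≤
          𝓕.spectralEx α n + ((k : ℝ) - k / α) * (1 - ε') * 𝓕.density *
            ((n + 1 : ℕ) : ℝ) ^ ((k : ℝ) - k / α - 1) := by
  have hα0 : 0 < α := one_pos.trans hα
  rcases le_or_gt ((1 - ε) * 𝓕.density) 0 with hd | hd
  · refine ⟨1, one_pos, .of_forall fun n H hH _ hnot => absurd ⟨hH, ?_⟩ hnot⟩
    exact (mul_nonpos_of_nonpos_of_nonneg hd (Nat.cast_nonneg _)).trans (Nat.cast_nonneg _)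
  obtain ⟨j, rfl⟩ := Nat.exists_eq_succ_of_ne_zero hk
  have hπ : 0 < 𝓕.density := 𝓕.density_nonneg.lt_of_ne' (right_ne_zero_of_mul hd.ne')
  obtain ⟨b, hb, hbε', hbd⟩ := exists_pos_lt_one_sub_mul_rpow_lt_mul_rpow (k := j) (s := 1 - ε')
    hα hd.le (by linarith [mul_pos hε hπ]) 𝓕.density_le_one (by
      rwa [sub_sub_cancel, one_sub_mul, sub_sub_cancel, ← Nat.cast_succ])
  obtain ⟨c, hc, hloss⟩ :=
    exists_eventually_spectralEx_succ_add_le hk hα hπ hb.le hbε'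
  refine ⟨c, hc, ?_⟩
  filter_upwards [hloss, (tendsto_add_atTop_nat 1).eventually
    (eventually_exists_rpow_lt hα hb.le hbd)] with n hloss hsmall H hH hHs hnot
  obtain ⟨v, hv⟩ := exists_degree_lt_of_notMem_largeMinDegree hH hnot
  obtain ⟨x, hx⟩ := H.exists_isPrincipalVector hα0
  obtain ⟨u, hu⟩ := hsmall H hHs ⟨v, hv.le⟩ x hx
  exact hloss H hH hHs x hx u hu

end KFamily

theorem theorem3p1_general {k : ℕ} (hk : k ≠ 0) {α : ℝ} (hα : 1 < α) {ε ε' : ℝ} (hε : 0 < ε)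
    (𝓕 : KFamily k) (hε' : ε' < ε * 𝓕.density / k)
    (hgrowth : ∃ N : ℕ, ∀ n : ℕ, N ≤ n →
      maxSpectralRadius α (𝓕.largeMinDegree ε (n - 1)) +
          ((k : ℝ) - k / α) * (1 - ε') * 𝓕.density * (n : ℝ) ^ ((k : ℝ) - k / α - 1) ≤
        maxSpectralRadius α (𝓕.largeMinDegree ε n)) :
    ∃ n₀ : ℕ, ∀ n : ℕ, n₀ ≤ n → ∀ H : KGraph (Fin n) k, H.IsFree 𝓕 →
      H.spectralRadius α ≤ maxSpectralRadius α (𝓕.largeMinDegree ε n) ∧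
      (H.spectralRadius α = maxSpectralRadius α (𝓕.largeMinDegree ε n) →
        H ∈ 𝓕.largeMinDegree ε n) := by
  obtain ⟨N, hN⟩ := hgrowth
  obtain ⟨c, hc, hloss⟩ :=
    KFamily.exists_eventually_spectralEx_succ_add_le_of_notMem hk hα hε hε'
  have hdiv : ¬ Summable fun n : ℕ => c * ((n + 1 : ℕ) : ℝ) ^ ((k : ℝ) - k / α - 1) := by
    rw [summable_mul_left_iff hc.ne',
      summable_nat_add_iff 1 (f := fun n : ℕ => (n : ℝ) ^ ((k : ℝ) - k / α - 1)),
      Real.summable_nat_rpow, not_lt]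
    linarith [div_le_self (Nat.cast_nonneg (α := ℝ) k) hα.le]
  refine eventually_atTop.1 (eventually_forall_le_maxSpectralRadius (one_pos.trans hα)
    (𝓖 := fun n => {G | G.IsFree 𝓕}) (fun n => by positivity) hdiv ?_)
  filter_upwards [hloss, eventually_ge_atTop N] with n hn hNn H hH hnot hHs
  have hgrow := hN (n + 1) (hNn.trans n.le_succ)
  rw [Nat.add_sub_cancel] at hgrow
  have hstep := hn H hH hHs hnot
  rw [KFamily.spectralEx, KFamily.spectralEx] at hstep
  linarith

theorem theorem3p1 (k : ℕ) (hk : 2 ≤ k) (α : ℝ) (hα : 1 < α) (ε : ℝ) (hε0 : 0 < ε) (hε1 : ε < 1)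
    (𝓕 : KFamily k) (hπ : 0 < 𝓕.density)
    (ε' : ℝ) (hε' : ε' = ε * 𝓕.density * (α - 1) / (2 * k * α))
    (hgrowth : ∃ N : ℕ, ∀ n : ℕ, N ≤ n →
      maxSpectralRadius α (𝓕.largeMinDegree ε (n - 1)) +
          ((k : ℝ) - k / α) * (1 - ε') * 𝓕.density * (n : ℝ) ^ ((k : ℝ) - k / α - 1) ≤
        maxSpectralRadius α (𝓕.largeMinDegree ε n)) :
    ∃ n₀ : ℕ, ∀ n : ℕ, n₀ ≤ n → ∀ H : KGraph (Fin n) k, H.IsFree 𝓕 →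
      H.spectralRadius α ≤ maxSpectralRadius α (𝓕.largeMinDegree ε n) ∧
      (H.spectralRadius α = maxSpectralRadius α (𝓕.largeMinDegree ε n) →
        H ∈ 𝓕.largeMinDegree ε n) := by
  have hα0 : 0 < α := one_pos.trans hα
  have hk0 : (0 : ℝ) < k := by positivity
  refine theorem3p1_general (by omega) hα hε0 𝓕 ?_ hgrowth
  rw [hε', div_lt_div_iff₀ (mul_pos (mul_pos two_pos hk0) hα0) hk0]
  nlinarith [mul_pos (mul_pos hε0 hπ) hk0]
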